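/- Let $g\ge 0$, let $\Lambda$ be a lattice of rank $2g$ and $E:\Lambda\times\Lambda\to\mathbb{Z}$ an alternating form of type $(1,\dots,1)$. Put $\Lambda_F=\Lambda\otimes_{\mathbb Z}F$ for $F = \mathbb{Q},\mathbb{R}$, and extend $E$ to $\Lambda_{\mathbb R}$. Let $$\mathfrak{H}_g=\{J\in \mathrm{GL}(\Lambda_{\mathbb R}) : J^2=-I,\ E(Jx,Jy)=E(x,y)\ \text{for all } x,y,\ E(x,Jx)>0\ \text{for all } x\ne 0\}$$ with the topology induced from $\mathrm{End}(\Lambda_{\mathbb R})$. The group $\mathrm{Sp}(\Lambda,E)$ of automorphisms of $\Lambda$ preserving $E$ acts on $\mathfrak{H}_g$ by conjugation; let $\mathsf{A}_g=\mathrm{Sp}(\Lambda,E)\backslash\mathfrak{H}_g$. For $J\in\mathfrak{H}_g$ let $\mathrm{End}_{\mathbb Q}(A_J)=\{f\in\mathrm{End}_{\mathbb Q}(\Lambda_{\mathbb Q}) : Jf=fJ\}$, where $f$ is extended $\mathbb{R}$-linearly to $\Lambda_{\mathbb R}$. For $J_0\in\mathfrak{H}_g$ and $D=\mathrm{End}_{\mathbb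 Q}(A_{J_0})$, the special subvariety of PEL type $\mathsf{Z}(D)\subseteq\mathsf{A}_g$ is the image in $\mathsf{A}_g$ of the connected component containing $J_0$ of $\{J\in\mathfrak{H}_g : D\subseteq \mathrm{End}_{\mathbb Q}(A_J)\}$. Let $G\subseteq \mathrm{Sp}(\Lambda,E)$ be a finite subgroup, let $\mathfrak{H}_g^G$ be the set of points of $\mathfrak{H}_g$ fixed by $G$, and let $D_G=\{f\in\mathrm{End}_{\mathbb Q}(\Lambda_{\mathbb Q}) : Jf=fJ\ \text{for all } J\in\mathfrak{H}_g^G\}$. Then the image of $\mathfrak{H}_g^G$ in $\mathsf{A}_g$ coincides with the special subvariety of PEL type $\mathsf{Z}(D_G)$. More precisely: there is $J_0\in\mathfrak{H}_g^G$ with $\mathrm{End}_{\mathbb Q}(A_{J_0})=D_G$, and for every $J_0\in\mathfrak{H}_g$ with $\mathrm{End}_{\mathbb Q}(A_{J_0})=D_G$ the image of $\mathfrak{H}_g^G$ in $\mathsf{A}_g$ equals $\mathsf{Z}(D_G)$ formed with the base point $J_0$. -/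

import Mathlib

open scoped TensorProduct

noncomputable section

namespace Siegel

variable {Λ : Type*} [AddCommGroup Λ]

/-- The `ℤ`-bilinear form `E` on `Λ` has type `(d₁, …, d_g)`: the `d_i` are positive, each divides
the next, and there is a `ℤ`-basis `e₁, …, e_g, f₁, …, f_g` of `Λ` with
`E(e_i, e_j) = E(f_i, f_j) = 0` and `E(e_i, f_j) = d_i δ_{ij}`. It is used for alternating forms,
so the values `E(f_j, e_i)` need not be listed. -/
def HasType {g : ℕ} (E : LinearMap.BilinForm ℤ Λ) (d : Fin g → ℕ) : Prop :=
  (∀ i, 0 < d i) ∧ (∀ i j, i ≤ j → d i ∣ d j) ∧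
    ∃ b : Module.Basis (Fin g ⊕ Fin g) ℤ Λ,
      (∀ i j, E (b (Sum.inl i)) (b (Sum.inl j)) = 0) ∧
      (∀ i j, E (b (Sum.inr i)) (b (Sum.inr j)) = 0) ∧
      (∀ i j, E (b (Sum.inl i)) (b (Sum.inr j)) = if i = j then (d i : ℤ) else 0)

/-- The group `Sp(Λ, E)` of automorphisms of the lattice `Λ` preserving `E`. -/
def Sp (E : LinearMap.BilinForm ℤ Λ) : Subgroup (Λ ≃ₗ[ℤ] Λ) where
  carrier := {γ | ∀ x y, E (γ x) (γ y) = E x y}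
  one_mem' := fun _ _ => rfl
  mul_mem' := by
    intro a b ha hb x y
    exact (ha (b x) (b y)).trans (hb x y)
  inv_mem' := by
    intro a ha x y
    have h := ha (a⁻¹ x) (a⁻¹ y)
    have e : ∀ z, a (a⁻¹ z) = z := fun z => a.apply_symm_apply z
    rw [e, e] at h
    exact h.symm

/-- Siegel's upper half-space: the complex structures `J` on `Λ_ℝ = ℝ ⊗ Λ` that preserve `E` and
satisfy `E(x, J x) > 0` for `x ≠ 0`. (`J² = -1` makes `J` invertible.) -/
@[ext]
structure HalfSpace (E : LinearMap.BilinForm ℤ Λ) where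
  /-- The underlying endomorphism of `Λ_ℝ`. -/
  J : Module.End ℝ (ℝ ⊗[ℤ] Λ)
  sq_eq : ∀ x, J (J x) = -x
  isometry : ∀ x y, E.baseChange ℝ (J x) (J y) = E.baseChange ℝ x y
  pos : ∀ x, x ≠ 0 → 0 < E.baseChange ℝ x (J x)

/-- The topology of the half-space as a subspace of the real vector space `End(Λ_ℝ)`; the latter
carries its module topology (the usual topology, since `Λ_ℝ` is finite-dimensional). -/
instance (E : LinearMap.BilinForm ℤ Λ) : TopologicalSpace (HalfSpace E) :=
  TopologicalSpace.induced HalfSpace.J (moduleTopology ℝ (Module.End ℝ (ℝ ⊗[ℤ] Λ)))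

/-- The extension `γ_ℝ` of a lattice automorphism `γ` to `Λ_ℝ`. -/
def realExt (γ : Λ ≃ₗ[ℤ] Λ) : Module.End ℝ (ℝ ⊗[ℤ] Λ) :=
  (γ : Λ →ₗ[ℤ] Λ).baseChange ℝ

theorem realExt_one : realExt (1 : Λ ≃ₗ[ℤ] Λ) = 1 :=
  LinearMap.baseChange_id

theorem realExt_mul (γ δ : Λ ≃ₗ[ℤ] Λ) : realExt (γ * δ) = realExt γ * realExt δ :=
  LinearMap.baseChange_comp (δ : Λ →ₗ[ℤ] Λ) (γ : Λ →ₗ[ℤ] Λ)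

theorem realExt_mul_inv (γ : Λ ≃ₗ[ℤ] Λ) : realExt γ * realExt γ⁻¹ = 1 := by
  rw [← realExt_mul, mul_inv_cancel, realExt_one]

theorem realExt_inv_mul (γ : Λ ≃ₗ[ℤ] Λ) : realExt γ⁻¹ * realExt γ = 1 := by
  rw [← realExt_mul, inv_mul_cancel, realExt_one]

theorem realExt_isometry {E : LinearMap.BilinForm ℤ Λ} {γ : Λ ≃ₗ[ℤ] Λ} (hγ : γ ∈ Sp E)
    (x y : ℝ ⊗[ℤ] Λ) :
    E.baseChange ℝ (realExt γ x) (realExt γ y) = E.baseChange ℝ x y := by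
  induction x using TensorProduct.induction_on with
  | zero => simp
  | add a b ha hb => simp only [map_add, LinearMap.add_apply, ha, hb]
  | tmul r u =>
    induction y using TensorProduct.induction_on with
    | zero => simp
    | add a b ha hb => simp only [map_add, ha, hb]
    | tmul s v =>
      have h : E (γ u) (γ v) = E u v := hγ u v
      simp [realExt, h]

/-- `Sp(Λ, E)` acts on the half-space by conjugation: `γ • J = γ_ℝ J γ_ℝ⁻¹`. -/
instance (E : LinearMap.BilinForm ℤ Λ) : MulAction (Sp E) (HalfSpace E) where
  smul γ J :=
    { J := realExt γ.1 * J.J * realExt γ.1⁻¹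
      sq_eq := by
        intro x
        have e : realExt γ.1 (realExt γ.1⁻¹ x) = x :=
          LinearMap.congr_fun (realExt_mul_inv γ.1) x
        have e' : ∀ y, realExt γ.1⁻¹ (realExt γ.1 y) = y :=
          LinearMap.congr_fun (realExt_inv_mul γ.1)
        simp only [Module.End.mul_apply]
        rw [e', J.sq_eq, map_neg, e]
      isometry := by
        intro x y
        simp only [Module.End.mul_apply]
        rw [realExt_isometry γ.2, J.isometry, realExt_isometry (inv_mem γ.2)]
      pos := by
        intro x hx
        have e : realExt γ.1 (realExt γ.1⁻¹ x) = x :=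
          LinearMap.congr_fun (realExt_mul_inv γ.1) x
        have h0 : realExt γ.1⁻¹ x ≠ 0 := by
          intro h
          rw [h, map_zero] at e
          exact hx e.symm
        have h := J.pos _ h0
        rw [← realExt_isometry γ.2, e] at h
        exact h }
  one_smul J := by
    apply HalfSpace.ext
    change realExt 1 * J.J * realExt 1⁻¹ = J.J
    rw [inv_one, realExt_one, one_mul, mul_one]
  mul_smul γ δ J := by
    apply HalfSpace.ext
    change realExt (γ.1 * δ.1) * J.J * realExt (γ.1 * δ.1)⁻¹
      = realExt γ.1 * (realExt δ.1 * J.J * realExt δ.1⁻¹) * realExt γ.1⁻¹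
    rw [mul_inv_rev, realExt_mul, realExt_mul]
    simp only [mul_assoc]

/-- The moduli space `A_g = Sp(Λ, E) \ H_g` (its underlying set). -/
abbrev ModuliSpace (E : LinearMap.BilinForm ℤ Λ) : Type _ :=
  MulAction.orbitRel.Quotient (Sp E) (HalfSpace E)

/-- The quotient map `H_g → A_g`. -/
def toModuli (E : LinearMap.BilinForm ℤ Λ) (J : HalfSpace E) : ModuliSpace E :=
  Quotient.mk _ J

/-- The `ℝ`-linear extension of rational endomorphisms,
`End(Λ_ℚ) → End(Λ_ℝ)`, via the canonical isomorphism `ℝ ⊗_ℚ Λ_ℚ ≃ Λ_ℝ`. -/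
def ratExt (f : Module.End ℚ (ℚ ⊗[ℤ] Λ)) : Module.End ℝ (ℝ ⊗[ℤ] Λ) :=
  (TensorProduct.AlgebraTensorModule.cancelBaseChange ℤ ℚ ℝ ℝ Λ).conj (f.baseChange ℝ)

theorem ratExt_mul (f h : Module.End ℚ (ℚ ⊗[ℤ] Λ)) : ratExt (f * h) = ratExt f * ratExt h := by
  unfold ratExt
  rw [LinearMap.baseChange_mul]
  exact LinearEquiv.conj_comp _ _ _

theorem ratExt_add (f h : Module.End ℚ (ℚ ⊗[ℤ] Λ)) : ratExt (f + h) = ratExt f + ratExt h := by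
  unfold ratExt
  rw [LinearMap.baseChange_add, map_add]

theorem ratExt_algebraMap (r : ℚ) :
    ratExt (algebraMap ℚ (Module.End ℚ (ℚ ⊗[ℤ] Λ)) r)
      = (r : ℝ) • (1 : Module.End ℝ (ℝ ⊗[ℤ] Λ)) := by
  unfold ratExt
  rw [Algebra.algebraMap_eq_smul_one, LinearMap.baseChange_smul, LinearMap.baseChange_one]
  apply LinearMap.ext
  intro x
  rw [LinearEquiv.conj_apply]
  have hr : ∀ z : ℝ ⊗[ℚ] (ℚ ⊗[ℤ] Λ), r • z = (r : ℝ) • z := fun z => by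
    rw [← algebraMap_smul ℝ r z]; rfl
  simp [hr]

/-- `End_ℚ(A_J)`: the `ℚ`-algebra of endomorphisms of `Λ_ℚ` whose extension to `Λ_ℝ` commutes
with `J`. -/
def endQ {E : LinearMap.BilinForm ℤ Λ} (J : HalfSpace E) :
    Subalgebra ℚ (Module.End ℚ (ℚ ⊗[ℤ] Λ)) where
  carrier := {f | J.J * ratExt f = ratExt f * J.J}
  mul_mem' := by
    intro a b ha hb
    have ha' : J.J * ratExt a = ratExt a * J.J := ha
    have hb' : J.J * ratExt b = ratExt b * J.J := hb
    change J.J * ratExt (a * b) = ratExt (a * b) * J.J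
    rw [ratExt_mul, ← mul_assoc, ha', mul_assoc, hb', mul_assoc]
  add_mem' := by
    intro a b ha hb
    have ha' : J.J * ratExt a = ratExt a * J.J := ha
    have hb' : J.J * ratExt b = ratExt b * J.J := hb
    change J.J * ratExt (a + b) = ratExt (a + b) * J.J
    rw [ratExt_add, mul_add, add_mul, ha', hb']
  algebraMap_mem' := by
    intro r
    change J.J * ratExt _ = ratExt _ * J.J
    rw [ratExt_algebraMap, mul_smul_comm, smul_mul_assoc, mul_one, one_mul]

/-- The fixed locus `H_g^G` of a subgroup `G` of `Sp(Λ, E)`. -/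
def fixedLocus {E : LinearMap.BilinForm ℤ Λ} (G : Subgroup (Sp E)) : Set (HalfSpace E) :=
  MulAction.fixedPoints G (HalfSpace E)

/-- `D_G`: the `ℚ`-algebra of endomorphisms of `Λ_ℚ` commuting with every `J` in `H_g^G`, that is,
the intersection of the algebras `End_ℚ(A_J)` over these `J`. -/
def algD {E : LinearMap.BilinForm ℤ Λ} (G : Subgroup (Sp E)) :
    Subalgebra ℚ (Module.End ℚ (ℚ ⊗[ℤ] Λ)) :=
  ⨅ J ∈ fixedLocus G, endQ J

theorem mem_algD {E : LinearMap.BilinForm ℤ Λ} (G : Subgroup (Sp E))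
    (f : Module.End ℚ (ℚ ⊗[ℤ] Λ)) :
    f ∈ algD G ↔ ∀ J ∈ fixedLocus G, J.J * ratExt f = ratExt f * J.J := by
  simp only [algD, Algebra.mem_iInf]
  rfl

/-- The special subvariety `Z(D)` of PEL type, where `D = End_ℚ(A_{J₀})`: the image in `A_g` of the
connected component containing `J₀` of the set of all `J` with `D ⊆ End_ℚ(A_J)`. -/
def pelSubvariety {E : LinearMap.BilinForm ℤ Λ} (J₀ : HalfSpace E) : Set (ModuliSpace E) :=
  toModuli E '' connectedComponentIn {J : HalfSpace E | endQ J₀ ≤ endQ J} J₀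

end Siegel

end

noncomputable section

namespace Siegel

open NormedSpace Matrix
open scoped Matrix.Norms.L2Operator MatrixOrder

/-! ### Positive definite matrices: logarithms, square roots, normalization of an alternating form.
-/

section MatrixExp

variable {n : Type*} [Fintype n] [DecidableEq n]

/-! The fixed locus is an exponential image of a real vector space. Averaging over the finite group
gives a `G`-invariant inner product; the polar decomposition of `E` relative to it yields
coordinates in which the Gram matrix `Ω` of `E` satisfies `Ω² = -1` and commutes with `G`
(`exists_normalized_basis`). Then `-Ω exp X` runs over the fixed locus as `X` runs over the
symmetric matrices that anticommute with `Ω` and commute with `G` (`range_ofSymmAnti`). Two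
consequences follow.

The fixed locus is connected. As `G ⊆ D_G`, it is also exactly the set of `J` with `D_G ⊆
End_ℚ(A_J)` (`setOf_algD_le`), so the connected component is all of it.

Commuting with a given `f` is an analytic condition on `X`, and for `f ∉ D_G` it is not identically
satisfied. There are countably many rational `f`, so by Baire some `X` violates all these conditions
at once, giving `End_ℚ(A_J) = D_G`. -/

theorem posDef_exp {X : Matrix n n ℝ} (hX : Xᵀ = X) : (exp X).PosDef := by
  have hX' : X.IsHermitian := by rw [Matrix.IsHermitian, conjTranspose_eq_transpose_of_trivial, hX]
  rw [← Matrix.isStrictlyPositive_iff_posDef]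
  exact ⟨hX'.isSelfAdjoint.exp_nonneg, Matrix.isUnit_exp X⟩

/-- The logarithm comes from functional calculus, hence commutes with whatever commutes with `K`;
this is how `G`-equivariance is carried along. -/
theorem exists_exp_eq {K : Matrix n n ℝ} (hK : K.PosDef) :
    ∃ X : Matrix n n ℝ, Xᵀ = X ∧ exp X = K ∧ ∀ M, Commute K M → Commute X M := by
  refine ⟨CFC.log K, ?_, CFC.exp_log K hK.isStrictlyPositive, fun M hM => hM.cfc_real _⟩
  have h : IsSelfAdjoint (CFC.log K) := IsSelfAdjoint.log
  rwa [IsSelfAdjoint, star_eq_conjTranspose, conjTranspose_eq_transpose_of_trivial] at h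

theorem exp_injective_of_symm {X Y : Matrix n n ℝ} (hX : Xᵀ = X) (hY : Yᵀ = Y)
    (h : exp X = exp Y) : X = Y := by
  have sa : ∀ {Z : Matrix n n ℝ}, Zᵀ = Z → IsSelfAdjoint Z := fun {Z} hZ => by
    rw [IsSelfAdjoint, star_eq_conjTranspose, conjTranspose_eq_transpose_of_trivial, hZ]
  rw [← CFC.log_exp X (sa hX), h, CFC.log_exp Y (sa hY)]

theorem exp_half_mul_self (X : Matrix n n ℝ) :
    exp ((1 / 2 : ℝ) • X) * exp ((1 / 2 : ℝ) • X) = exp X := by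
  rw [← Matrix.exp_add_of_commute _ _ (Commute.refl _), ← add_smul]
  norm_num

/-- The symmetric square root of a positive definite matrix. -/
theorem exists_posDef_sqrt {K : Matrix n n ℝ} (hK : K.PosDef) :
    ∃ Q : Matrix n n ℝ, Q.PosDef ∧ Qᵀ = Q ∧ Q * Q = K ∧ ∀ M, Commute K M → Commute Q M := by
  obtain ⟨X, hX, rfl, hc⟩ := exists_exp_eq hK
  have hs : ((1 / 2 : ℝ) • X)ᵀ = (1 / 2 : ℝ) • X := by rw [transpose_smul, hX]
  refine ⟨exp ((1 / 2 : ℝ) • X), posDef_exp hs, ?_, exp_half_mul_self X, fun M hM => ?_⟩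
  · rw [← Matrix.exp_transpose, hs]
  · exact ((hc M hM).smul_left _).exp_left

/-- If the matrices in `S` preserve a positive definite form `H` and a nondegenerate alternating form
`Ω`, then some change of coordinates turns `Ω` into a complex structure commuting with `S`. -/
theorem exists_normalization {S : Set (Matrix n n ℝ)} {Ω H : Matrix n n ℝ} (hΩ : Ωᵀ = -Ω)
    (hΩu : IsUnit Ω) (hH : H.PosDef) (hSH : ∀ M ∈ S, Mᵀ * H * M = H)
    (hSΩ : ∀ M ∈ S, Mᵀ * Ω * M = Ω) :
    ∃ C : (Matrix n n ℝ)ˣ, ∃ Ω' : Matrix n n ℝ, Ω = (C : Matrix n n ℝ)ᵀ * Ω' * C ∧ Ω'ᵀ = -Ω' ∧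
      Ω' * Ω' = -1 ∧ ∀ M ∈ S, Commute Ω' (C * M * (C⁻¹ : (Matrix n n ℝ)ˣ)) := by
  have inv_symm : ∀ {A : Matrix n n ℝ}, Aᵀ = A → (A⁻¹)ᵀ = A⁻¹ := fun {A} hA => by
    rw [transpose_nonsing_inv, hA]
  obtain ⟨R, hRp, hRt, hRR, -⟩ := exists_posDef_sqrt hH
  have hRd : IsUnit R.det := (isUnit_iff_isUnit_det R).1 hRp.isUnit
  have rs : R * R⁻¹ = 1 := mul_nonsing_inv R hRd
  have sr : R⁻¹ * R = 1 := nonsing_inv_mul R hRd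
  have hst := inv_symm hRt
  set s := R⁻¹ with hs
  have rs' : ∀ x, R * (s * x) = x := fun x => by rw [← mul_assoc, rs, one_mul]
  have sr' : ∀ x, s * (R * x) = x := fun x => by rw [← mul_assoc, sr, one_mul]
  have hΩ₁t : (s * Ω * s)ᵀ = -(s * Ω * s) := by
    simp only [transpose_mul, hst, hΩ, mul_assoc, neg_mul, mul_neg]
  have hΩ₁u : IsUnit (s * Ω * s) := by
    have hsu : IsUnit s := ⟨⟨s, R, sr, rs⟩, rfl⟩
    exact (hsu.mul hΩu).mul hsu
  have hΩR : R * (s * Ω * s) * R = Ω := by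
    simp only [mul_assoc, sr, mul_one, rs']
  set Ω₁ := s * Ω * s with hΩ₁
  -- In the new coordinates `M` is orthogonal, so preserving `Ω₁` means commuting with it.
  have hcomm : ∀ M ∈ S, Commute Ω₁ (R * M * s) := by
    intro M hM
    have h1 : (R * M * s)ᵀ * (R * M * s) = 1 := by
      have h := hSH M hM
      rw [← hRR] at h
      calc (R * M * s)ᵀ * (R * M * s) = s * (Mᵀ * (R * R) * M) * s := by
            simp only [transpose_mul, hst, hRt, mul_assoc]
        _ = 1 := by rw [h, ← mul_assoc, sr, one_mul, rs]
    have h2 : (R * M * s)ᵀ * Ω₁ * (R * M * s) = Ω₁ := by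
      calc (R * M * s)ᵀ * Ω₁ * (R * M * s) = s * (Mᵀ * Ω * M) * s := by
            simp only [hΩ₁, transpose_mul, hst, hRt, mul_assoc, rs', sr']
        _ = Ω₁ := by rw [hSΩ M hM]
    have h3 := mul_eq_one_comm.1 h1
    change Ω₁ * (R * M * s) = (R * M * s) * Ω₁
    nth_rw 2 [← h2]
    rw [mul_assoc _ Ω₁, ← mul_assoc (R * M * s), h3, one_mul]
  have hK : (Ω₁ᵀ * Ω₁).PosDef := by
    rw [← conjTranspose_eq_transpose_of_trivial]
    exact PosDef.conjTranspose_mul_self Ω₁ (mulVec_injective_of_isUnit hΩ₁u)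
  rw [hΩ₁t] at hK
  -- Polar decomposition: `P = √(-Ω₁²)` is the absolute value of `Ω₁`. Rescaling by `Q = √P` on both
  -- sides leaves the orthogonal factor, whose square is `-1`.
  obtain ⟨P, hPp, -, hPP, hPc⟩ := exists_posDef_sqrt hK
  obtain ⟨Q, hQp, hQt, hQQ, hQc⟩ := exists_posDef_sqrt hPp
  have hQΩ : Commute Q Ω₁ := hQc _ (hPc _ (((Commute.refl Ω₁).neg_left).mul_left (Commute.refl _)))
  have hQM : ∀ M ∈ S, Commute Q (R * M * s) := fun M hM =>
    hQc _ (hPc _ (((hcomm M hM).neg_left).mul_left (hcomm M hM)))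
  have hQd : IsUnit Q.det := (isUnit_iff_isUnit_det Q).1 hQp.isUnit
  have qt : Q * Q⁻¹ = 1 := mul_nonsing_inv Q hQd
  have tq : Q⁻¹ * Q = 1 := nonsing_inv_mul Q hQd
  have htt := inv_symm hQt
  have hinv : ∀ M, Commute Q M → Commute Q⁻¹ M := fun M hM =>
    Commute.units_inv_left (u := ⟨Q, Q⁻¹, qt, tq⟩) hM
  set t := Q⁻¹ with ht
  have qt' : ∀ x, Q * (t * x) = x := fun x => by rw [← mul_assoc, qt, one_mul]
  have tq' : ∀ x, t * (Q * x) = x := fun x => by rw [← mul_assoc, tq, one_mul]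
  have htΩ := hinv _ hQΩ
  refine ⟨⟨Q * R, s * t, by simp only [mul_assoc, rs', qt], by simp only [mul_assoc, tq', sr]⟩,
    t * Ω₁ * t, ?_, ?_, ?_, ?_⟩
  · conv_lhs => rw [← hΩR]
    simp only [transpose_mul, hRt, hQt, mul_assoc, qt', tq']
  · simp only [transpose_mul, htt, hΩ₁t, mul_assoc, neg_mul, mul_neg]
  · have h4 : Ω₁ * Ω₁ = -(Q * Q * (Q * Q)) := by
      rw [hQQ, hPP, neg_mul, neg_neg]
    have h5 : t * Ω₁ * t = Ω₁ * (t * t) := by rw [htΩ.eq, mul_assoc]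
    have h6 : Ω₁ * (t * t) = t * t * Ω₁ := (htΩ.mul_left htΩ).eq.symm
    calc t * Ω₁ * t * (t * Ω₁ * t) = t * t * Ω₁ * (Ω₁ * (t * t)) := by rw [h5, ← h6]
      _ = t * t * (Ω₁ * Ω₁) * (t * t) := by simp only [mul_assoc]
      _ = -1 := by rw [h4]; simp only [mul_assoc, neg_mul, mul_neg, tq', qt', qt]
  · intro M hM
    have e : Q * R * M * (s * t) = R * M * s := by
      calc Q * R * M * (s * t) = Q * (R * M * s) * t := by simp only [mul_assoc]
        _ = R * M * s := by rw [(hQM M hM).eq, mul_assoc, qt, mul_one]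
    have h5 := hinv _ (hQM M hM)
    change Commute (t * Ω₁ * t) (Q * R * M * (s * t))
    rw [e]
    exact (h5.mul_left (hcomm M hM)).mul_left h5

end MatrixExp

/-- Countably many nonzero analytic maps have a common point of nonvanishing. -/
theorem exists_forall_ne_zero_of_analytic {W F ι : Type*} [NormedAddCommGroup W] [NormedSpace ℝ W]
    [CompleteSpace W] [NormedAddCommGroup F] [NormedSpace ℝ F] [Countable ι] (h : ι → W → F)
    (ha : ∀ i, AnalyticOnNhd ℝ (h i) Set.univ) (hne : ∀ i, ∃ x, h i x ≠ 0) :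
    ∃ x, ∀ i, h i x ≠ 0 := by
  have hc : ∀ i, Continuous (h i) := fun i =>
    continuousOn_univ.1 (ha i).continuousOn
  -- Baire: by the identity theorem the zero set of a nonzero analytic map on `W` has empty
  -- interior.
  have hd : Dense (⋂ i, {x | h i x ≠ 0}) := by
    refine dense_iInter_of_isOpen (fun i => isOpen_ne_fun (hc i) continuous_const) fun i => ?_
    rw [← compl_compl {x | h i x ≠ 0}, ← interior_eq_empty_iff_dense_compl,
      Set.eq_empty_iff_forall_notMem]
    intro z hz
    obtain ⟨x, hx⟩ := hne i
    have he : h i =ᶠ[nhds z] fun _ => 0 := by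
      filter_upwards [mem_interior_iff_mem_nhds.1 hz] with y hy
      simpa using hy
    exact hx (congrFun ((ha i).eq_of_eventuallyEq (fun _ _ => analyticAt_const) he) x)
  obtain ⟨x, hx⟩ := hd.nonempty
  exact ⟨x, fun i => Set.mem_iInter.1 hx i⟩

/-! ### The linear parameter space and its exponential. -/

section Param

variable {n : Type*} [Fintype n] [DecidableEq n]

/-- The symmetric matrices anticommuting with `Ω` and commuting with the elements of `S`. -/
def symmAnti (Ω : Matrix n n ℝ) (S : Set (Matrix n n ℝ)) : Submodule ℝ (Matrix n n ℝ) where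
  carrier := {X | Xᵀ = X ∧ Ω * X = -(X * Ω) ∧ ∀ M ∈ S, M * X = X * M}
  zero_mem' := by simp
  add_mem' := by
    rintro X Y ⟨h1, h2, h3⟩ ⟨k1, k2, k3⟩
    refine ⟨by rw [transpose_add, h1, k1], by rw [mul_add, add_mul, h2, k2, neg_add], ?_⟩
    intro M hM
    rw [mul_add, add_mul, h3 M hM, k3 M hM]
  smul_mem' := by
    rintro c X ⟨h1, h2, h3⟩
    refine ⟨by rw [transpose_smul, h1], by rw [mul_smul_comm, smul_mul_assoc, h2, smul_neg], ?_⟩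
    intro M hM
    rw [mul_smul_comm, smul_mul_assoc, h3 M hM]

/-- Conjugation by `Ω`, whose inverse is `-Ω`, sends `X` to `-X` and commutes with `exp`. -/
theorem mul_exp_of_anti {Ω X : Matrix n n ℝ} (hΩΩ : Ω * Ω = -1) (h : Ω * X = -(X * Ω)) :
    Ω * exp X = exp (-X) * Ω := by
  have u1 : Ω * -Ω = 1 := by rw [mul_neg, hΩΩ, neg_neg]
  have u2 : -Ω * Ω = 1 := by rw [neg_mul, hΩΩ, neg_neg]
  have e := Matrix.exp_units_conj ⟨Ω, -Ω, u1, u2⟩ X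
  have e' : Ω * X * -Ω = -X := by rw [h, mul_neg, neg_mul, neg_neg, mul_assoc, hΩΩ, mul_neg, mul_one]
  change exp (Ω * X * -Ω) = Ω * exp X * -Ω at e
  rw [e'] at e
  rw [e, mul_assoc, u2, mul_one]

theorem exp_mul_exp_neg (X : Matrix n n ℝ) : exp X * exp (-X) = 1 := by
  rw [← Matrix.exp_add_of_commute _ _ (Commute.refl X).neg_right, add_neg_cancel, exp_zero]

/-- A positive definite `P` with `P Ω P = Ω` is the exponential of a symmetric matrix anticommuting
with `Ω`. -/
theorem exists_symmAnti_exp_eq {Ω P : Matrix n n ℝ} {S : Set (Matrix n n ℝ)} (hΩΩ : Ω * Ω = -1)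
    (hΩ : Ωᵀ = -Ω) (hP : P.PosDef) (hPΩ : P * Ω * P = Ω) (hS : ∀ M ∈ S, Commute P M) :
    ∃ X ∈ symmAnti Ω S, exp X = P := by
  obtain ⟨X, hX, rfl, hc⟩ := exists_exp_eq hP
  refine ⟨X, ⟨hX, ?_, fun M hM => (hc M (hS M hM)).eq.symm⟩, rfl⟩
  have u1 : Ω * -Ω = 1 := by rw [mul_neg, hΩΩ, neg_neg]
  have u2 : -Ω * Ω = 1 := by rw [neg_mul, hΩΩ, neg_neg]
  have e := Matrix.exp_units_conj ⟨Ω, -Ω, u1, u2⟩ X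
  change exp (Ω * X * -Ω) = Ω * exp X * -Ω at e
  -- `P Ω P = Ω` says that conjugation by `Ω` inverts `P`; injectivity of `exp` on symmetric
  -- matrices turns this into `Ω X Ω⁻¹ = -X`.
  have h1 : exp X * exp (Ω * X * -Ω) = 1 := by
    rw [e, ← mul_assoc, ← mul_assoc, hPΩ, u1]
  have h2 : exp (Ω * X * -Ω) = exp (-X) := by
    rw [← one_mul (exp (Ω * X * -Ω)), ← mul_eq_one_comm.1 (exp_mul_exp_neg X), mul_assoc, h1,
      mul_one]
  have h3 : Ω * X * -Ω = -X := by
    refine exp_injective_of_symm ?_ (by rw [transpose_neg, hX]) h2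
    simp only [transpose_mul, transpose_neg, hΩ, hX, neg_neg, mul_neg, neg_mul, mul_assoc]
  calc Ω * X = Ω * X * -Ω * Ω := by rw [mul_assoc, u2, mul_one]
    _ = -(X * Ω) := by rw [h3, neg_mul]

/-- The exponential parametrization of the complex structures is analytic, so the locus where it
fails to commute with given matrices is generic. -/
theorem exists_symmAnti_forall_not_commute {ι : Type*} [Countable ι] (Ω : Matrix n n ℝ)
    (W : Submodule ℝ (Matrix n n ℝ)) (F : ι → Matrix n n ℝ)
    (hF : ∀ i, ∃ X ∈ W, Ω * exp X * F i ≠ F i * (Ω * exp X)) :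
    ∃ X ∈ W, ∀ i, Ω * exp X * F i ≠ F i * (Ω * exp X) := by
  obtain ⟨x, hx⟩ := exists_forall_ne_zero_of_analytic
    (fun i (X : W) => Ω * exp (X : Matrix n n ℝ) * F i - F i * (Ω * exp (X : Matrix n n ℝ)))
    (fun i X _ => by
      have h1 : AnalyticAt ℝ (fun X : W => exp (X : Matrix n n ℝ)) X :=
        (exp_analytic (𝕂 := ℝ) (X : Matrix n n ℝ)).comp (W.subtypeL.analyticAt X)
      have h2 := (analyticAt_const (v := Ω)).mul h1
      exact (h2.mul analyticAt_const).sub (analyticAt_const.mul h2))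
    (fun i => by
      obtain ⟨X, hX, h⟩ := hF i
      exact ⟨⟨X, hX⟩, sub_ne_zero.2 h⟩)
  exact ⟨x, x.2, fun i => sub_ne_zero.1 (hx i)⟩

end Param

/-! ### The fixed locus in terms of commutation, and adapted coordinates on `Λ_ℝ`. -/

variable {Λ : Type*} [AddCommGroup Λ]

theorem ratExt_baseChange (f : Λ →ₗ[ℤ] Λ) : ratExt (f.baseChange ℚ) = f.baseChange ℝ := by
  refine TensorProduct.AlgebraTensorModule.ext fun r x => ?_
  simp [ratExt, LinearEquiv.conj_apply]

variable {E : LinearMap.BilinForm ℤ Λ}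

theorem mem_fixedLocus_iff (G : Subgroup (Sp E)) (J : HalfSpace E) :
    J ∈ fixedLocus G ↔ ∀ γ ∈ G, Commute (realExt γ.1) J.J := by
  have key : ∀ γ : Sp E, γ • J = J ↔ Commute (realExt γ.1) J.J := by
    intro γ
    have h1 : (γ • J).J = realExt γ.1 * J.J * realExt γ.1⁻¹ := rfl
    rw [HalfSpace.ext_iff, h1]
    constructor
    · intro h
      change realExt γ.1 * J.J = J.J * realExt γ.1
      nth_rw 2 [← h]
      rw [mul_assoc _ _ (realExt γ.1), realExt_inv_mul, mul_one]
    · intro h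
      rw [h.eq, mul_assoc, realExt_mul_inv, mul_one]
  exact ⟨fun h γ hγ => (key γ).1 (h ⟨γ, hγ⟩), fun h γ => (key γ.1).2 (h γ.1 γ.2)⟩

/-- The elements of `G`, viewed as rational endomorphisms, lie in `D_G`; commuting with `D_G`
therefore forces being fixed by `G`. -/
theorem setOf_algD_le (G : Subgroup (Sp E)) : {J : HalfSpace E | algD G ≤ endQ J} = fixedLocus G := by
  ext J
  refine ⟨fun h => (mem_fixedLocus_iff G J).2 fun γ hγ => ?_, fun h => (iInf₂_le J h : algD G ≤ endQ J)⟩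
  have hm : ((γ.1 : Λ →ₗ[ℤ] Λ).baseChange ℚ) ∈ algD G := by
    rw [mem_algD]
    intro J' hJ'
    rw [ratExt_baseChange]
    exact ((mem_fixedLocus_iff G J').1 hJ' γ hγ).eq.symm
  have h2 : J.J * ratExt _ = ratExt _ * J.J := h hm
  rw [ratExt_baseChange] at h2
  exact h2.symm

theorem toMatrix_commute_iff {n : Type*} [Fintype n] [DecidableEq n] (b : Module.Basis n ℝ (ℝ ⊗[ℤ] Λ))
    (f h : Module.End ℝ (ℝ ⊗[ℤ] Λ)) :
    f * h = h * f ↔ f.toMatrix b b * h.toMatrix b b = h.toMatrix b b * f.toMatrix b b := by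
  rw [← LinearMap.toMatrix_mul, ← LinearMap.toMatrix_mul]
  exact (LinearMap.toMatrix b b).injective.eq_iff.symm

theorem mulVec_dotProduct_mulVec {n : Type*} [Fintype n] (A B Ω : Matrix n n ℝ) (u v : n → ℝ) :
    A *ᵥ u ⬝ᵥ Ω *ᵥ (B *ᵥ v) = u ⬝ᵥ (Aᵀ * Ω * B) *ᵥ v := by
  rw [← vecMul_transpose, ← dotProduct_mulVec, mulVec_mulVec, mulVec_mulVec]

theorem eq_of_forall_dotProduct_mulVec {n : Type*} [Fintype n] [DecidableEq n] {A B : Matrix n n ℝ}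
    (h : ∀ u v, u ⬝ᵥ A *ᵥ v = u ⬝ᵥ B *ᵥ v) : A = B := by
  ext i j
  simpa using h (Pi.single i 1) (Pi.single j 1)

theorem toMatrix_mulVec_equivFun {n V : Type*} [Fintype n] [DecidableEq n] [AddCommGroup V]
    [Module ℝ V] (b : Module.Basis n ℝ V) (f : Module.End ℝ V) (x : V) :
    b.equivFun (f x) = f.toMatrix b b *ᵥ b.equivFun x :=
  (LinearMap.toMatrix_mulVec_repr b b f x).symm

theorem toLin_equivFun {n V : Type*} [Fintype n] [DecidableEq n] [AddCommGroup V]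
    [Module ℝ V] (b : Module.Basis n ℝ V) (A : Matrix n n ℝ) (x : V) :
    b.equivFun (Matrix.toLin b b A x) = A *ᵥ b.equivFun x := by
  rw [toMatrix_mulVec_equivFun, LinearMap.toMatrix_toLin]

/-- The Gram matrix is preserved by an isometry. -/
theorem transpose_mul_mul_eq_of_isometry {n V : Type*} [Fintype n] [DecidableEq n] [AddCommGroup V]
    [Module ℝ V] (b : Module.Basis n ℝ V) {Ω : Matrix n n ℝ} {B : LinearMap.BilinForm ℝ V}
    (hB : ∀ x y, B x y = b.equivFun x ⬝ᵥ Ω *ᵥ b.equivFun y) {f : Module.End ℝ V}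
    (hf : ∀ x y, B (f x) (f y) = B x y) :
    (f.toMatrix b b)ᵀ * Ω * f.toMatrix b b = Ω := by
  refine eq_of_forall_dotProduct_mulVec fun u v => ?_
  obtain ⟨x, rfl⟩ := b.equivFun.surjective u
  obtain ⟨y, rfl⟩ := b.equivFun.surjective v
  rw [← mulVec_dotProduct_mulVec, ← toMatrix_mulVec_equivFun, ← toMatrix_mulVec_equivFun, ← hB, hf,
    hB]

/-- A basis of `Λ_ℝ` in which `E` and `G` are normalized. -/
theorem exists_normalized_basis {g : ℕ} (hAlt : E.IsAlt) (hType : HasType E (fun _ : Fin g => 1))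
    (G : Subgroup (Sp E)) [Finite G] :
    ∃ (b : Module.Basis (Fin g ⊕ Fin g) ℝ (ℝ ⊗[ℤ] Λ)) (Ω : Matrix (Fin g ⊕ Fin g) (Fin g ⊕ Fin g) ℝ),
      (∀ x y, E.baseChange ℝ x y = b.equivFun x ⬝ᵥ Ω *ᵥ b.equivFun y) ∧ Ωᵀ = -Ω ∧ Ω * Ω = -1 ∧
      ∀ γ ∈ G, Commute Ω ((realExt γ.1).toMatrix b b) := by
  obtain ⟨-, -, b₀, h11, h22, h12⟩ := hType
  set c := Algebra.TensorProduct.basis ℝ b₀ with hc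
  set Ω₀ := LinearMap.BilinForm.toMatrix c (E.baseChange ℝ) with hΩ₀
  have hform : ∀ x y, E.baseChange ℝ x y = c.equivFun x ⬝ᵥ Ω₀ *ᵥ c.equivFun y := by
    intro x y
    rw [hΩ₀, Module.Basis.equivFun_apply, LinearMap.BilinForm.dotProduct_toMatrix_mulVec]
    congr 1
    · simp
    · simp
  -- The sign arises because `Matrix.J` has `-1` in its upper right block.
  have hΩ₀eq : Ω₀ = -J (Fin g) ℝ := by
    have h21 : ∀ i j, E (b₀ (Sum.inr i)) (b₀ (Sum.inl j)) = if i = j then (-1 : ℤ) else 0 := by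
      intro i j
      rw [← hAlt.neg_eq, h12]
      simp only [eq_comm (a := j)]
      split_ifs <;> simp
    have h21' : ∀ i j : Fin g, (if i = j then (-1 : ℝ) else 0) = -if i = j then 1 else 0 := by
      intro i j
      split_ifs <;> simp
    ext (i | i) (j | j) <;>
      simp [hΩ₀, hc, LinearMap.BilinForm.toMatrix_apply, J, h11, h22, h12, h21, h21', one_apply]
  set T : Sp E → Matrix (Fin g ⊕ Fin g) (Fin g ⊕ Fin g) ℝ := fun γ => (realExt γ.1).toMatrix c c with hT
  have hTΩ : ∀ γ, (T γ)ᵀ * Ω₀ * T γ = Ω₀ := by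
    exact fun γ => transpose_mul_mul_eq_of_isometry c hform (realExt_isometry γ.2)
  have := Fintype.ofFinite G
  -- The standard inner product averaged over `G`; the term at `γ = 1` is the identity, which makes
  -- the sum positive definite.
  set H : Matrix (Fin g ⊕ Fin g) (Fin g ⊕ Fin g) ℝ := ∑ γ : G, (T γ)ᵀ * T γ with hH
  have hTmul : ∀ γ δ, T (γ * δ) = T γ * T δ := by
    intro γ δ
    simp only [hT, Subgroup.coe_mul, realExt_mul, LinearMap.toMatrix_mul]
  have hT1 : T 1 = 1 := by
    simp only [hT, Subgroup.coe_one, realExt_one, LinearMap.toMatrix_one]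
  have hHp : H.PosDef := by
    classical
    rw [hH, ← Finset.add_sum_erase _ _ (Finset.mem_univ (1 : G))]
    refine PosDef.add_posSemidef ?_ (posSemidef_sum _ fun γ _ => ?_)
    · rw [Subgroup.coe_one, hT1, transpose_one, one_mul]
      exact PosDef.one
    · rw [← conjTranspose_eq_transpose_of_trivial]
      exact posSemidef_conjTranspose_mul_self _
  have hHi : ∀ γ ∈ G, (T γ)ᵀ * H * T γ = H := by
    intro γ hγ
    rw [hH, Finset.mul_sum, Finset.sum_mul]
    refine Fintype.sum_equiv (Equiv.mulRight (⟨γ, hγ⟩ : G)) _ _ fun δ => ?_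
    simp only [Equiv.coe_mulRight, Subgroup.coe_mul, hTmul, transpose_mul, mul_assoc]
  obtain ⟨C, Ω, hC, hΩt, hΩΩ, hcomm⟩ := exists_normalization (S := T '' G) (Ω := Ω₀) (H := H)
    (by rw [hΩ₀eq, transpose_neg, J_transpose])
    (by rw [hΩ₀eq]; exact ((isUnit_iff_isUnit_det _).2 (isUnit_det_J _ _)).neg)
    hHp (by rintro _ ⟨γ, hγ, rfl⟩; exact hHi γ hγ) (by rintro _ ⟨γ, -, rfl⟩; exact hTΩ γ)
  set e := Matrix.toLin'OfInv C.inv_mul C.mul_inv with he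
  set b := Module.Basis.ofEquivFun (c.equivFun.trans e) with hb
  have hbc : ∀ x, b.equivFun x = (C : Matrix _ _ ℝ) *ᵥ c.equivFun x := by
    intro x
    rw [hb, Module.Basis.equivFun_ofEquivFun, LinearEquiv.trans_apply, he]
    simp [Matrix.toLin'OfInv]
  refine ⟨b, Ω, fun x y => ?_, hΩt, hΩΩ, fun γ hγ => ?_⟩
  · rw [hbc, hbc, mulVec_dotProduct_mulVec, ← hC, hform]
  · have h := hcomm (T γ) ⟨γ, hγ, rfl⟩
    convert h using 1
    refine eq_of_forall_dotProduct_mulVec fun u v => ?_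
    obtain ⟨y, rfl⟩ := b.equivFun.surjective v
    rw [← toMatrix_mulVec_equivFun, hbc, hbc, toMatrix_mulVec_equivFun, mulVec_mulVec, mulVec_mulVec,
      Units.inv_mul_cancel_right]

/-! ### The exponential parametrization of the fixed locus. -/

section Param

variable {n : Type*} [Fintype n] [DecidableEq n] (b : Module.Basis n ℝ (ℝ ⊗[ℤ] Λ))
  {Ω : Matrix n n ℝ} (hE : ∀ x y, E.baseChange ℝ x y = b.equivFun x ⬝ᵥ Ω *ᵥ b.equivFun y)
  (hΩ : Ωᵀ = -Ω) (hΩΩ : Ω * Ω = -1)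

/-- The point `-Ω exp X` of the half-space. -/
def ofSymmAnti {S : Set (Matrix n n ℝ)} (X : symmAnti Ω S) : HalfSpace E where
  J := Matrix.toLin b b (-(Ω * exp (X : Matrix n n ℝ)))
  sq_eq x := by
    apply b.equivFun.injective
    obtain ⟨X, -, hX, -⟩ := X
    rw [toLin_equivFun, toLin_equivFun, mulVec_mulVec, map_neg]
    have : -(Ω * exp X) * -(Ω * exp X) = -1 := by
      nth_rw 1 [mul_exp_of_anti hΩΩ hX]
      rw [neg_mul_neg, mul_assoc, ← mul_assoc Ω, hΩΩ, neg_mul, one_mul, mul_neg,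
        mul_eq_one_comm.1 (exp_mul_exp_neg X)]
    rw [this, neg_mulVec, one_mulVec]
  isometry x y := by
    obtain ⟨X, hXt, hX, -⟩ := X
    rw [hE, hE, toLin_equivFun, toLin_equivFun, mulVec_dotProduct_mulVec]
    have : (-(Ω * exp X))ᵀ * Ω * -(Ω * exp X) = Ω := by
      rw [transpose_neg, transpose_mul, hΩ, ← Matrix.exp_transpose, hXt]
      simp only [mul_neg, neg_neg]
      rw [mul_assoc (exp X), hΩΩ, mul_neg, mul_one, neg_mul, neg_neg, mul_exp_of_anti hΩΩ hX, ← mul_assoc,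
        exp_mul_exp_neg, one_mul]
    rw [this]
  pos x hx := by
    obtain ⟨X, hXt, hX, -⟩ := X
    -- The minus sign in `-Ω exp X` makes `exp X` the matrix of `E(x, Jx)`.
    rw [hE, toLin_equivFun, mulVec_mulVec, mul_neg, ← mul_assoc, hΩΩ, neg_mul, neg_neg, one_mul]
    have h := (posDef_exp hXt).dotProduct_mulVec_pos (x := b.equivFun x) (by simpa using hx)
    simpa using h

theorem ofSymmAnti_J {S : Set (Matrix n n ℝ)} (X : symmAnti Ω S) :
    (ofSymmAnti b hE hΩ hΩΩ X).J = Matrix.toLin b b (-(Ω * exp (X : Matrix n n ℝ))) := rfl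

theorem ofSymmAnti_commute_iff {S : Set (Matrix n n ℝ)} (X : symmAnti Ω S)
    (f : Module.End ℝ (ℝ ⊗[ℤ] Λ)) :
    (ofSymmAnti b hE hΩ hΩΩ X).J * f = f * (ofSymmAnti b hE hΩ hΩΩ X).J ↔
      Ω * exp (X : Matrix n n ℝ) * f.toMatrix b b = f.toMatrix b b * (Ω * exp (X : Matrix n n ℝ)) := by
  rw [toMatrix_commute_iff b, ofSymmAnti_J, LinearMap.toMatrix_toLin, neg_mul, mul_neg, neg_inj]

variable (G : Subgroup (Sp E))

/-- The matrices of the elements of `G`. -/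
def matrices : Set (Matrix n n ℝ) := (fun γ : Sp E => (realExt γ.1).toMatrix b b) '' G

/-- Conversely to the construction, if `J` has matrix `M`, then `Ω M` is the matrix of `E(x, Jy)`,
hence symmetric and positive definite; `X` is its logarithm. -/
theorem range_ofSymmAnti (hG : ∀ γ ∈ G, Commute Ω ((realExt γ.1).toMatrix b b)) :
    Set.range (ofSymmAnti b hE hΩ hΩΩ (S := matrices b G)) = fixedLocus G := by
  ext J
  rw [mem_fixedLocus_iff]
  constructor
  · rintro ⟨X, rfl⟩ γ hγ
    refine ((ofSymmAnti_commute_iff b hE hΩ hΩΩ X _).2 ?_).symm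
    have h : Commute (exp (X : Matrix n n ℝ)) ((realExt γ.1).toMatrix b b) :=
      Commute.exp_left (X.2.2.2 _ ⟨γ, hγ, rfl⟩).symm
    exact ((hG γ hγ).mul_left h).eq
  · intro hJ
    set M := J.J.toMatrix b b with hM
    have hMM : M * M = -1 := by
      rw [hM, ← LinearMap.toMatrix_mul, ← LinearMap.toMatrix_one b, ← map_neg]
      congr 1
      exact LinearMap.ext J.sq_eq
    have hMΩ := transpose_mul_mul_eq_of_isometry b hE J.isometry
    rw [← hM] at hMΩ
    have hMΩ' : Mᵀ * Ω = -(Ω * M) := by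
      nth_rw 2 [← hMΩ]
      rw [mul_assoc (Mᵀ * Ω), hMM, mul_neg, mul_one, neg_neg]
    have hP : (Ω * M).PosDef := by
      refine PosDef.of_dotProduct_mulVec_pos ?_ fun u hu => ?_
      · rw [Matrix.IsHermitian, conjTranspose_eq_transpose_of_trivial, transpose_mul, hΩ, mul_neg,
          hMΩ', neg_neg]
      · obtain ⟨x, rfl⟩ := b.equivFun.surjective u
        have h := J.pos x (by simpa using hu)
        rw [hE, toMatrix_mulVec_equivFun, mulVec_mulVec] at h
        simpa using h
    obtain ⟨X, hX, hXP⟩ := exists_symmAnti_exp_eq (S := matrices b G) hΩΩ hΩ hP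
      (by rw [mul_assoc (Ω * M), ← mul_assoc Ω Ω, hΩΩ, neg_mul, one_mul, mul_neg, mul_assoc, hMM,
            mul_neg, neg_neg, mul_one])
      (by
        rintro _ ⟨γ, hγ, rfl⟩
        exact (hG γ hγ).mul_left ((toMatrix_commute_iff b _ _).1 (hJ γ hγ).eq.symm))
    refine ⟨⟨X, hX⟩, HalfSpace.ext ?_⟩
    rw [ofSymmAnti_J]
    change Matrix.toLin b b (-(Ω * exp X)) = J.J
    rw [hXP, ← mul_assoc, hΩΩ, neg_mul, one_mul, neg_neg, hM, Matrix.toLin_toMatrix]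

theorem continuous_ofSymmAnti [Module.Free ℤ Λ] [Module.Finite ℤ Λ] (S : Set (Matrix n n ℝ)) :
    Continuous (ofSymmAnti b hE hΩ hΩΩ (S := S)) := by
  rw [continuous_induced_rng]
  -- This is the topology from which that of `HalfSpace E` is induced; linear maps into it from
  -- matrices are continuous.
  let _ : TopologicalSpace (Module.End ℝ (ℝ ⊗[ℤ] Λ)) := moduleTopology ℝ _
  have : IsModuleTopology ℝ (Module.End ℝ (ℝ ⊗[ℤ] Λ)) := ⟨rfl⟩
  have : ContinuousAdd (Module.End ℝ (ℝ ⊗[ℤ] Λ)) := IsModuleTopology.toContinuousAdd ℝ _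
  have : IsTopologicalAddGroup (Module.End ℝ (ℝ ⊗[ℤ] Λ)) := IsModuleTopology.topologicalAddGroup ℝ _
  have h1 : Continuous (Matrix.toLin b b) :=
    LinearMap.continuous_of_finiteDimensional (Matrix.toLin b b).toLinearMap
  have h2 : Continuous fun X : symmAnti Ω S => exp (X : Matrix n n ℝ) :=
    (continuous_iff_continuousAt.2 fun X => (exp_analytic (𝕂 := ℝ) X).continuousAt).comp
      continuous_subtype_val
  exact h1.comp (continuous_const.mul h2).neg

end Param

/-! ### Existence of a point with endomorphism algebra `D_G`. -/

instance countable_end_rat [Module.Free ℤ Λ] [Module.Finite ℤ Λ] :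
    Countable (Module.End ℚ (ℚ ⊗[ℤ] Λ)) := by
  let b := Module.Free.chooseBasis ℚ (Module.End ℚ (ℚ ⊗[ℤ] Λ))
  exact b.equivFun.toEquiv.countable_iff.2 inferInstance

/-- Each `f ∉ D_G` fails to commute with some fixed `J`, and there are only countably many such `f`,
so a generic parameter excludes them all. -/
theorem exists_endQ_eq_algD [Module.Free ℤ Λ] [Module.Finite ℤ Λ] {n : Type*} [Fintype n]
    [DecidableEq n] (b : Module.Basis n ℝ (ℝ ⊗[ℤ] Λ)) {Ω : Matrix n n ℝ}
    (hE : ∀ x y, E.baseChange ℝ x y = b.equivFun x ⬝ᵥ Ω *ᵥ b.equivFun y)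
    (hΩ : Ωᵀ = -Ω) (hΩΩ : Ω * Ω = -1) (G : Subgroup (Sp E))
    (hG : ∀ γ ∈ G, Commute Ω ((realExt γ.1).toMatrix b b)) :
    ∃ J₀ ∈ fixedLocus G, endQ J₀ = algD G := by
  have hrange := range_ofSymmAnti b hE hΩ hΩΩ G hG
  obtain ⟨X, hX, hXf⟩ := exists_symmAnti_forall_not_commute Ω (symmAnti Ω (matrices b G))
    (fun f : {f : Module.End ℚ (ℚ ⊗[ℤ] Λ) // f ∉ algD G} => (ratExt f.1).toMatrix b b) (by
      rintro ⟨f, hf⟩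
      rw [mem_algD] at hf
      push Not at hf
      obtain ⟨J, hJ, hJf⟩ := hf
      rw [← hrange] at hJ
      obtain ⟨X, rfl⟩ := hJ
      exact ⟨X, X.2, fun h => hJf ((ofSymmAnti_commute_iff b hE hΩ hΩΩ X _).2 h)⟩)
  have hmem : ofSymmAnti b hE hΩ hΩΩ (⟨X, hX⟩ : symmAnti Ω (matrices b G)) ∈ fixedLocus G := by
    rw [← hrange]
    exact ⟨_, rfl⟩
  refine ⟨_, hmem, le_antisymm (fun f hf => ?_) (iInf₂_le _ hmem)⟩
  by_contra hfD
  exact hXf ⟨f, hfD⟩ ((ofSymmAnti_commute_iff b hE hΩ hΩΩ _ _).1 hf)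

end Siegel

end

theorem mainTheorem6 {g : ℕ} {Λ : Type*} [AddCommGroup Λ] [Module.Free ℤ Λ] [Module.Finite ℤ Λ]
    (hrank : Module.finrank ℤ Λ = 2 * g)
    (E : LinearMap.BilinForm ℤ Λ) (hAlt : E.IsAlt)
    (hType : Siegel.HasType E (fun _ : Fin g => 1))
    (G : Subgroup (Siegel.Sp E)) [Finite G] :
    (∃ J₀ ∈ Siegel.fixedLocus G, Siegel.endQ J₀ = Siegel.algD G) ∧
    ∀ J₀ : Siegel.HalfSpace E, Siegel.endQ J₀ = Siegel.algD G →
      Siegel.toModuli E '' Siegel.fixedLocus G = Siegel.pelSubvariety J₀ := by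
  obtain ⟨b, Ω, hE, hΩ, hΩΩ, hG⟩ := Siegel.exists_normalized_basis hAlt hType G
  refine ⟨Siegel.exists_endQ_eq_algD b hE hΩ hΩΩ G hG, fun J₀ hJ₀ => ?_⟩
  have hconn : IsPreconnected (Siegel.fixedLocus G) := by
    rw [← Siegel.range_ofSymmAnti b hE hΩ hΩΩ G hG]
    exact isPreconnected_range (Siegel.continuous_ofSymmAnti b hE hΩ hΩΩ _)
  have hset := Siegel.setOf_algD_le G
  have hmem : J₀ ∈ Siegel.fixedLocus G := by
    rw [← hset]
    exact hJ₀.ge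
  -- The component of a point in a preconnected set is the whole set.
  rw [Siegel.pelSubvariety, hJ₀, hset, hconn.connectedComponentIn hmem]
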